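/- Fix an arbitrary acceptable programming system $\varphi$ for the partial computable functions $\mathbb N\to\mathbb N$ (the map $(e,x)\mapsto\varphi_e(x)$ is partial computable, and for every partial computable $(e,x)\mapsto\psi_e(x)$ there is a total computable $f$ with $\varphi_{f(e)}=\psi_e$ for all $e$), and let $W_e=\mathrm{dom}(\varphi_e)$. A language is a computably enumerable set $L\subseteq\mathbb N$. A text is any function $T:\mathbb N\to\mathbb N\cup\{\#\}$; $\mathrm{content}(T)=\mathrm{range}(T)\setminus\{\#\}$, $\mathrm{content}(T[i])=\{T(0),\dots,T(i-1)\}\setminus\{\#\}$, and $T$ is a text for $L$ if $\mathrm{content}(T)=L$. A learner is a partial computable function $h$; in set-driven learning its sequence of hypotheses on $T$ is $p(i)=h(\mathrm{content}(T[i]))$, where finite sets are given to $h$ by their canonical codes. For such $p$ and $T$ consider the following restrictions, each of which includes the requirement that $p$ be total: - $\mathbf{Ex}$: there is $n_0$ such that for all $n\ge n_0$, $p(n)=p(n_0)$ and $W_{p(n_0)}=\mathrm{content}(T)$; - $\mathbf{Conv}$ (conservative): for all $i$, if $\mathrm{content}(T[i+1])\subseteq W_{p(i)}$ then $p(i)=p(i+1)$;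 - $\mathbf{SDec}$ (strongly decisive): for all $i\le j\le k$, if $W_{p(i)}=W_{p(k)}$ then $p(j)=p(i)$; - $\mathbf{Caut}$ (cautious): for all $i,j$, if $W_{p(i)}\subsetneq W_{p(j)}$ then $i<j$. Juxtaposition denotes conjunction of restrictions. For a restriction $\delta$, let $[\mathbf{TxtSd}\delta]$ be the set of all classes $\mathcal L$ of languages for which there is a single learner $h$ such that, for every $L\in\mathcal L$ and every text $T$ for $L$, the sequence of hypotheses of $h$ on $T$ satisfies $\delta$ with respect to $T$. Then $$[\mathbf{TxtSdEx}]=[\mathbf{TxtSdConvSDecCautEx}].$$ That is, every set-driven learnable class is set-driven learnable by a learner that is simultaneously conservative, strongly decisive and cautious on all texts for languages in the class. -/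

import Mathlib

namespace LimitLearning

/-- An acceptable programming system for the partial computable functions `ℕ → ℕ`: the universal
function `(e, x) ↦ φ_e(x)` is partial computable, and every uniformly partial computable family
`ψ` can be compiled into `φ` by a total computable function. -/
def IsAcceptable (φ : ℕ → ℕ →. ℕ) : Prop :=
  Partrec₂ φ ∧
    ∀ ψ : ℕ → ℕ →. ℕ, Partrec₂ ψ → ∃ f : ℕ → ℕ, Computable f ∧ ∀ e, φ (f e) = ψ e

/-- `W_e`, the domain of `φ_e`. -/
def W (φ : ℕ → ℕ →. ℕ) (e : ℕ) : Set ℕ := (φ e).Dom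

/-- A language is a computably enumerable set of natural numbers. -/
def IsLanguage (L : Set ℕ) : Prop := REPred (fun x : ℕ => x ∈ L)

/-- A text is an arbitrary total function `ℕ → ℕ ∪ {#}`; the pause `#` is `none`. -/
abbrev Text : Type := ℕ → Option ℕ

/-- `content(T)`. -/
def content (T : Text) : Set ℕ := {x | ∃ i, T i = some x}

/-- `content(T[i])`, the finite set of data among `T(0), …, T(i-1)`. -/
def contentInit (T : Text) (i : ℕ) : Finset ℕ :=
  (Finset.range i).biUnion fun k => (T k).toFinset

/-- `T` is a text for `L`. -/
def IsTextFor (T : Text) (L : Set ℕ) : Prop := content T = L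

/-- The canonical index `∑_{x ∈ D} 2^x` of a finite set `D`; this is the (bijective) coding by
which finite sets are given to functions on `ℕ`. -/
def finsetCode (D : Finset ℕ) : ℕ := ∑ x ∈ D, 2 ^ x

/-- An interaction operator turns a function (the learner) and a text into a sequence of
hypotheses. -/
abbrev InteractionOperator : Type := (ℕ →. ℕ) → Text → (ℕ →. ℕ)

/-- Set-driven learning: `Sd(h,T)(i) = h(content(T[i]))`. -/
def Sd : InteractionOperator := fun h T i => h (finsetCode (contentInit T i))

/-- A learning restriction is a predicate on a sequence of hypotheses and a text. -/
abbrev LearningRestriction : Type := (ℕ →. ℕ) → Text → Prop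

/-- `p` is total and, as a total sequence, satisfies `P` together with the text. -/
def onTotal (P : (ℕ → ℕ) → Text → Prop) : LearningRestriction :=
  fun p T => ∃ q : ℕ → ℕ, (∀ i, q i ∈ p i) ∧ P q T

/-- Explanatory learning. -/
def Ex (φ : ℕ → ℕ →. ℕ) : LearningRestriction :=
  onTotal fun p T => ∃ n₀, ∀ n, n₀ ≤ n → p n = p n₀ ∧ W φ (p n₀) = content T

/-- Conservative learning. -/
def Conv (φ : ℕ → ℕ →. ℕ) : LearningRestriction :=
  onTotal fun p T => ∀ i, (contentInit T (i + 1) : Set ℕ) ⊆ W φ (p i) → p i = p (i + 1)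

/-- Strongly decisive learning. -/
def SDec (φ : ℕ → ℕ →. ℕ) : LearningRestriction :=
  onTotal fun p _ => ∀ i j k, i ≤ j ∧ j ≤ k ∧ W φ (p i) = W φ (p k) → p j = p i

/-- Cautious learning. -/
def Caut (φ : ℕ → ℕ →. ℕ) : LearningRestriction :=
  onTotal fun p _ => ∀ i j, W φ (p i) ⊂ W φ (p j) → i < j

/-- `h` learns `L` with interaction operator `β` under the restriction `δ`: the restriction is
met on all texts for `L`. -/
def Learns (β : InteractionOperator) (δ : LearningRestriction) (h : ℕ →. ℕ) (L : Set ℕ) : Prop :=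
  ∀ T : Text, IsTextFor T L → δ (β h T) T

/-- `[Txt β δ]`: the set of all classes of languages such that one partial computable learner
learns every member of the class. -/
def TxtLearnable (β : InteractionOperator) (δ : LearningRestriction) : Set (Set (Set ℕ)) :=
  {𝓛 | (∀ L ∈ 𝓛, IsLanguage L) ∧ ∃ h : ℕ →. ℕ, Nat.Partrec h ∧ ∀ L ∈ 𝓛, Learns β δ h L}

end LimitLearning

/-! Only one inclusion needs work. Let `h` be a set-driven explanatory learner. The new learner lets
its hypothesis depend on the data D only through a canonical finite initial segment E of D, the
base, on which `h` is stable within D. Goodness, a recursive condition, says that no shorter good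
initial segment of E is already stable on E. Hence bases are unique, and every finite set has one.

The hypothesis attached to E is not the language of `h` on E itself, but a trimmed version
(`conjecture`): E together with larger elements of that language, added only while `h` is seen to
keep its value on all sets between E and the extension. So E is always initial and stable in its own
conjecture, whether or not `h` was right.

By `IsBase.eq_of_subset`, a conjecture based on E therefore contains no different base of later
data. This yields conservativeness, strong decisiveness and caution together. For convergence, a
locking set argument gives each learned language L a base E (`Learns.exists_isBase`). Since `h` is
stable between E and L, nothing is trimmed and the conjecture is L (`conjecture_eq`). Once the data
contain E, their base is E. -/

namespace LimitLearning

/-! ### Stable initial segments and bases -/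

section Bases

variable {α : Type*} (H : Finset ℕ → α)

/-- `E` is an initial segment of `S` with respect to the order of `ℕ`. -/
def IsInitial (E : Finset ℕ) (S : Set ℕ) : Prop :=
  (E : Set ℕ) ⊆ S ∧ ∀ x ∈ S, ∀ e ∈ E, x ≤ e → x ∈ E

/-- `H` does not change its value on the finite sets between `E` and `S`. -/
def StableOn (E : Finset ℕ) (S : Set ℕ) : Prop :=
  ∀ D : Finset ℕ, E ⊆ D → (D : Set ℕ) ⊆ S → H D = H E

/-- `E` refutes the stability of all its proper good initial segments. -/
def Good (E : Finset ℕ) : Prop :=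
  ∀ E' : Finset ℕ, E' ⊂ E → IsInitial E' E → Good E' → ¬ StableOn H E' E
termination_by E.card
decreasing_by exact Finset.card_lt_card ‹_›

/-- `E` is a good initial segment of `S` on which `H` is stable within `S`. -/
structure IsBase (E : Finset ℕ) (S : Set ℕ) : Prop where
  isInitial : IsInitial E S
  stableOn : StableOn H E S
  good : Good H E

variable {H}

theorem IsInitial.refl (E : Finset ℕ) : IsInitial E E :=
  ⟨subset_rfl, fun _ hx _ _ _ => hx⟩

theorem IsInitial.mono {E : Finset ℕ} {S S' : Set ℕ} (h : IsInitial E S') (hE : ↑E ⊆ S)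
    (hS : S ⊆ S') : IsInitial E S :=
  ⟨hE, fun x hx => h.2 x (hS hx)⟩

theorem IsInitial.trans {E F : Finset ℕ} {S : Set ℕ} (h : IsInitial E F) (h' : IsInitial F S) :
    IsInitial E S :=
  ⟨h.1.trans h'.1, fun x hx e he hxe => h.2 x (h'.2 x hx e (h.1 he) hxe) e he hxe⟩

theorem StableOn.mono {E : Finset ℕ} {S S' : Set ℕ} (h : StableOn H E S') (hS : S ⊆ S') :
    StableOn H E S :=
  fun D hD hDS => h D hD (hDS.trans hS)

theorem StableOn.refl (E : Finset ℕ) : StableOn H E E := fun _ hD hDE =>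
  congrArg H (subset_antisymm (Finset.coe_subset.1 hDE) hD)

theorem IsBase.mono {E : Finset ℕ} {S S' : Set ℕ} (h : IsBase H E S') (hE : ↑E ⊆ S)
    (hS : S ⊆ S') : IsBase H E S :=
  ⟨h.1.mono hE hS, h.2.mono hS, h.3⟩

/-- If `E` and `E'` are distinct bases of growing sets, then `E'` contains a witness against every
set in which `E` is initial and stable. -/
theorem IsBase.eq_of_subset {E E' : Finset ℕ} {D D' S : Set ℕ} (hE : IsBase H E D)
    (hE' : IsBase H E' D') (hD : D ⊆ D') (hS : IsInitial E S) (hS' : StableOn H E S)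
    (h : ↑E' ⊆ S) : E = E' := by
  have hED' : ↑E ⊆ D' := hE.isInitial.1.trans hD
  -- If some e in E were missing from E', all of E' would lie below e. Then E' would be a good
  -- proper initial segment, stable on E, against the goodness of E.
  have hsub : E ⊆ E' := by
    intro e he
    by_contra hne
    have hlt : E' ⊂ E := by
      refine Finset.ssubset_iff_subset_ne.2 ⟨fun x hx => ?_, fun heq => hne (heq ▸ he)⟩
      refine hS.2 x (h hx) e he (le_of_not_gt fun hex => hne ?_)
      exact hE'.isInitial.2 e (hED' he) x hx hex.le
    have hg := hE.good
    rw [Good] at hg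
    exact hg E' hlt (hE'.isInitial.mono (Finset.coe_subset.2 hlt.1) hED') hE'.good
      (hE'.stableOn.mono hED')
  -- Now E is a good proper initial segment of E', stable on E' because E' lies in S. This
  -- contradicts the goodness of E'.
  by_contra hne
  have hg := hE'.good
  rw [Good] at hg
  exact hg E (Finset.ssubset_iff_subset_ne.2 ⟨hsub, hne⟩)
    (hS.mono (Finset.coe_subset.2 hsub) h) hE.good (hS'.mono h)

theorem IsBase.unique {E E' : Finset ℕ} {S : Set ℕ} (hE : IsBase H E S) (hE' : IsBase H E' S) :
    E = E' :=
  hE.eq_of_subset hE' subset_rfl hE.isInitial hE.stableOn hE'.isInitial.1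

theorem exists_isBase (H : Finset ℕ → α) (D : Finset ℕ) : ∃ E, IsBase H E D := by
  by_cases hD : Good H D
  · exact ⟨D, IsInitial.refl D, StableOn.refl D, hD⟩
  · rw [Good] at hD
    push Not at hD
    obtain ⟨E, -, h1, h2, h3⟩ := hD
    exact ⟨E, h1, h3, h2⟩

theorem isBase_empty (H : Finset ℕ → α) : IsBase H ∅ ((∅ : Finset ℕ) : Set ℕ) := by
  obtain ⟨E, hE⟩ := exists_isBase H ∅
  rwa [Finset.subset_empty.1 (Finset.coe_subset.1 hE.isInitial.1)] at hE

theorem isInitial_filter_lt (D : Finset ℕ) (n : ℕ) : IsInitial (D.filter (· < n)) D := by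
  refine ⟨Finset.coe_subset.2 (Finset.filter_subset _ _), fun x hx e he hxe => ?_⟩
  rw [Finset.mem_filter] at he ⊢
  exact ⟨hx, hxe.trans_lt he.2⟩

theorem isInitial_filter_lt_succ (D : Finset ℕ) (n : ℕ) :
    IsInitial (D.filter (· < n)) (D.filter (· < n + 1) : Finset ℕ) :=
  (isInitial_filter_lt D n).mono
    (Finset.coe_subset.2 (Finset.monotone_filter_right _ fun _ _ h => Nat.lt_succ_of_lt h))
    (Finset.coe_subset.2 (Finset.filter_subset _ _))

theorem IsBase.filter_lt_succ_of_stableOn {D E : Finset ℕ} {n : ℕ}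
    (hE : IsBase H E (D.filter (· < n) : Finset ℕ))
    (h : StableOn H E (D.filter (· < n + 1) : Finset ℕ)) :
    IsBase H E (D.filter (· < n + 1) : Finset ℕ) :=
  ⟨hE.isInitial.trans (isInitial_filter_lt_succ D n), h, hE.good⟩

/-- A good proper initial segment cannot contain the possible maximum n, so if it were stable it
would also be a base of the old set. By uniqueness it would be E, which is not stable. -/
theorem IsBase.filter_lt_succ_of_not_stableOn {D E : Finset ℕ} {n : ℕ}
    (hE : IsBase H E (D.filter (· < n) : Finset ℕ))
    (h : ¬ StableOn H E (D.filter (· < n + 1) : Finset ℕ)) :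
    IsBase H (D.filter (· < n + 1)) (D.filter (· < n + 1) : Finset ℕ) := by
  refine ⟨IsInitial.refl _, StableOn.refl _, ?_⟩
  rw [Good]
  intro E' hlt hi hg hs
  have hsub : E' ⊆ D.filter (· < n) := by
    intro x hx
    obtain ⟨hxD, hxn⟩ := Finset.mem_filter.1 (hlt.1 hx)
    refine Finset.mem_filter.2 ⟨hxD, lt_of_le_of_ne (Nat.lt_succ_iff.1 hxn) ?_⟩
    rintro rfl
    refine hlt.2 fun y hy => hi.2 y hy x hx ?_
    exact Nat.lt_succ_iff.1 (Finset.mem_filter.1 hy).2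
  have hE' : IsBase H E' (D.filter (· < n) : Finset ℕ) :=
    IsBase.mono ⟨hi, hs, hg⟩ (Finset.coe_subset.2 hsub) (isInitial_filter_lt_succ D n).1
  exact h (hE.unique hE' ▸ hs)

theorem exists_isInitial_superset {S : Set ℕ} {D : Finset ℕ} (hD : ↑D ⊆ S) :
    ∃ F : Finset ℕ, D ⊆ F ∧ IsInitial F S := by
  classical
  refine ⟨(Finset.range (D.sup id + 1)).filter (· ∈ S), fun x hx => ?_, fun x hx => ?_,
    fun x hx e he hxe => ?_⟩
  · exact Finset.mem_filter.2
      ⟨Finset.mem_range.2 (Nat.lt_succ_of_le (Finset.le_sup (f := id) hx)), hD hx⟩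
  · exact (Finset.mem_filter.1 hx).2
  · have := Finset.mem_range.1 (Finset.mem_filter.1 he).1
    exact Finset.mem_filter.2 ⟨Finset.mem_range.2 (hxe.trans_lt this), hx⟩

/-- If some finite set is stable on `S`, then `S` has a base. -/
theorem exists_isBase_of_stableOn {S : Set ℕ} {D₀ : Finset ℕ} (hD₀ : ↑D₀ ⊆ S)
    (hs : StableOn H D₀ S) : ∃ E, IsBase H E S := by
  obtain ⟨F, hDF, hF⟩ := exists_isInitial_superset hD₀
  obtain ⟨E, hE⟩ := exists_isBase H F
  by_cases h : StableOn H E S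
  · exact ⟨E, hE.isInitial.trans hF, h, hE.good⟩
  · unfold StableOn at h
    push Not at h
    obtain ⟨D, hED, hDS, hne⟩ := h
    obtain ⟨G, hG, hGS⟩ := exists_isInitial_superset (S := S) (D := F ∪ D)
      (by simpa using ⟨hF.1, hDS⟩)
    obtain ⟨E', hE'⟩ := exists_isBase H G
    have hE'S := hE'.isInitial.trans hGS
    have hFG : F ⊆ G := Finset.union_subset_left hG
    -- Otherwise E' lies in F and is a base of F, so E' = E; but E' is stable on G, which contains
    -- the witness D against E.
    have hFE' : F ⊆ E' := by
      intro x hx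
      by_contra hxE'
      have hE'F : E' ⊆ F := fun y hy => hF.2 y (hE'S.1 hy) x hx
        (le_of_not_ge fun hxy => hxE' (hE'S.2 x (hF.1 hx) y hy hxy))
      have := (hE'.mono (Finset.coe_subset.2 hE'F) (Finset.coe_subset.2 hFG)).unique hE
      exact hne (hE'.stableOn.mono (Finset.coe_subset.2 (Finset.union_subset_right hG)) D
        (this ▸ hED) subset_rfl |>.trans (congrArg H this))
    refine ⟨E', hE'S, fun K hK hKS => ?_, hE'.good⟩
    rw [hs K (hDF.trans (hFE'.trans hK)) hKS, hs E' (hDF.trans hFE') hE'S.1]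

/-- A locking set argument: if `H` converges along every increasing exhaustion of `S`, then it is
stable above some finite subset of `S`. -/
theorem exists_stableOn_of_eventually_const {S : Set ℕ}
    (hH : ∀ D : ℕ → Finset ℕ, Monotone D → (⋃ n, (D n : Set ℕ)) = S →
      ∃ n₀, ∀ n, n₀ ≤ n → H (D n) = H (D n₀)) :
    ∃ D₀ : Finset ℕ, ↑D₀ ⊆ S ∧ StableOn H D₀ S := by
  classical
  by_contra! hcon
  -- Without a locking set, n can be absorbed and the value of `H` still changed; iterating gives an
  -- exhaustion of S along which `H` never settles.
  have step : ∀ (D : {D : Finset ℕ // ↑D ⊆ S}) (n : ℕ), ∃ D' : {D : Finset ℕ // ↑D ⊆ S},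
      D.1 ⊆ D'.1 ∧ (n ∈ S → n ∈ D'.1) ∧ H D'.1 ≠ H D.1 := by
    rintro ⟨D, hD⟩ n
    obtain ⟨D₁, hD₁, hDD₁, hn⟩ : ∃ D₁ : Finset ℕ, ↑D₁ ⊆ S ∧ D ⊆ D₁ ∧ (n ∈ S → n ∈ D₁) := by
      by_cases hn : n ∈ S
      · exact ⟨insert n D, by simpa [Set.insert_subset_iff] using ⟨hn, hD⟩,
          Finset.subset_insert _ _, fun _ => Finset.mem_insert_self _ _⟩
      · exact ⟨D, hD, subset_rfl, fun h => absurd h hn⟩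
    by_cases hne : H D₁ = H D
    · have := hcon D₁ hD₁
      unfold StableOn at this
      push Not at this
      obtain ⟨D₂, h1, h2, h3⟩ := this
      exact ⟨⟨D₂, h2⟩, hDD₁.trans h1, fun h => h1 (hn h), fun h => h3 (h.trans hne.symm)⟩
    · exact ⟨⟨D₁, hD₁⟩, hDD₁, hn, hne⟩
  choose next h1 h2 h3 using step
  let D : ℕ → {D : Finset ℕ // ↑D ⊆ S} :=
    fun n => Nat.rec ⟨∅, by simp⟩ (fun n E => next E n) n
  have hmono : Monotone fun n => (D n).1 := monotone_nat_of_le_succ fun n => h1 (D n) n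
  obtain ⟨n₀, hn₀⟩ := hH (fun n => (D n).1) hmono (by
    refine subset_antisymm (Set.iUnion_subset fun n => (D n).2) fun x hx => ?_
    exact Set.mem_iUnion.2 ⟨x + 1, h2 (D x) x hx⟩)
  exact h3 (D n₀) n₀ (hn₀ (n₀ + 1) n₀.le_succ)

end Bases

/-! ### From texts to increasing exhaustions -/

section Texts

theorem mem_contentInit {T : Text} {i x : ℕ} : x ∈ contentInit T i ↔ ∃ k < i, T k = some x := by
  simp [contentInit]

theorem contentInit_mono (T : Text) : Monotone (contentInit T) := fun _ _ hij _ hx => by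
  obtain ⟨k, hk, h⟩ := mem_contentInit.1 hx
  exact mem_contentInit.2 ⟨k, hk.trans_le hij, h⟩

theorem coe_contentInit_subset (T : Text) (i : ℕ) : (contentInit T i : Set ℕ) ⊆ content T :=
  fun _ hx => let ⟨k, _, h⟩ := mem_contentInit.1 hx; ⟨k, h⟩

theorem exists_subset_contentInit {T : Text} {D : Finset ℕ} (hD : ↑D ⊆ content T) :
    ∃ i, D ⊆ contentInit T i := by
  classical
  induction D using Finset.induction_on with
  | empty => exact ⟨0, Finset.empty_subset _⟩
  | insert a D _ ih =>
    rw [Finset.coe_insert, Set.insert_subset_iff] at hD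
    obtain ⟨i, hi⟩ := ih hD.2
    obtain ⟨k, hk⟩ := hD.1
    refine ⟨max i (k + 1), Finset.insert_subset ?_ (hi.trans (contentInit_mono T (le_max_left _ _)))⟩
    exact mem_contentInit.2 ⟨k, lt_of_lt_of_le k.lt_succ_self (le_max_right _ _), hk⟩

/-- Every increasing sequence of finite sets is passed through by a text for its union. -/
theorem exists_text_of_monotone {D : ℕ → Finset ℕ} (hD : Monotone D) :
    ∃ (T : Text) (t : ℕ → ℕ), (∀ n, n ≤ t n) ∧ (∀ n, contentInit T (t n) = D n) ∧
      content T = ⋃ n, (D n : Set ℕ) := by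
  -- The pause between blocks makes every block nonempty, so the prefix lengths grow even when the
  -- sets do not.
  let σ : ℕ → List (Option ℕ) := fun n =>
    Nat.rec ((D 0).toList.map some) (fun n l => l ++ none :: (D (n + 1)).toList.map some) n
  have hσ : ∀ n, σ (n + 1) = σ n ++ none :: (D (n + 1)).toList.map some := fun _ => rfl
  have hpre : ∀ {m n}, m ≤ n → σ m <+: σ n := by
    intro m n hmn
    induction hmn with
    | refl => exact List.prefix_rfl
    | step _ ih => exact ih.trans (List.prefix_append _ _)
  have hlen : ∀ n, n ≤ (σ n).length := by
    intro n
    induction n with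
    | zero => exact Nat.zero_le _
    | succ n ih => rw [hσ]; simp; omega
  have hmem : ∀ n x, some x ∈ σ n ↔ x ∈ D n := by
    intro n x
    induction n with
    | zero => simp [σ]
    | succ n ih =>
      rw [hσ]
      simp only [List.mem_append, ih, List.mem_cons, List.mem_map, Finset.mem_toList]
      simpa using fun h => hD n.le_succ h
  let T : Text := fun i => ((σ (i + 1))[i]?).join
  have hT : ∀ n i, i < (σ n).length → (σ n)[i]? = some (T i) := by
    intro n i hi
    have hi' : i < (σ (i + 1)).length := hlen (i + 1)
    have : (σ n)[i]? = (σ (i + 1))[i]? := by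
      rcases le_total n (i + 1) with h | h
      · obtain ⟨l, hl⟩ := hpre h
        rw [← hl, List.getElem?_append_left hi]
      · obtain ⟨l, hl⟩ := hpre h
        rw [← hl, List.getElem?_append_left hi']
    rw [this]
    simp [T, List.getElem?_eq_getElem hi']
  have hinit : ∀ n, contentInit T (σ n).length = D n := by
    intro n
    ext x
    rw [mem_contentInit, ← hmem, List.mem_iff_getElem?]
    refine exists_congr fun i => ⟨fun ⟨hi, h⟩ => by rw [hT n i hi, h], fun h => ?_⟩
    obtain ⟨hi, -⟩ := List.getElem?_eq_some_iff.1 h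
    exact ⟨hi, by rw [hT n i hi] at h; exact Option.some.inj h⟩
  refine ⟨T, fun n => (σ n).length, hlen, hinit, ?_⟩
  refine subset_antisymm ?_ (Set.iUnion_subset fun n => ?_)
  · rintro x ⟨i, hi⟩
    refine Set.mem_iUnion.2 ⟨i + 1, ?_⟩
    rw [← hinit]
    exact mem_contentInit.2 ⟨i, hlen (i + 1), hi⟩
  · rw [← hinit]
    exact coe_contentInit_subset _ _

theorem Learns.exists_limit {φ : ℕ → ℕ →. ℕ} {h : ℕ →. ℕ} {L : Set ℕ} (hL : Learns Sd (Ex φ) h L)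
    {D : ℕ → Finset ℕ} (hD : Monotone D) (hDL : (⋃ n, (D n : Set ℕ)) = L) :
    (∀ n, (h (finsetCode (D n))).Dom) ∧
      ∃ v n₀, W φ v = L ∧ ∀ n, n₀ ≤ n → h (finsetCode (D n)) = Part.some v := by
  obtain ⟨T, t, ht, hT, hTL⟩ := exists_text_of_monotone hD
  obtain ⟨q, hq, n₀, hn₀⟩ := hL T (hTL.trans hDL)
  have hq' : ∀ n, h (finsetCode (D n)) = Part.some (q (t n)) := fun n => by
    have := hq (t n)
    rw [Sd, hT] at this
    exact Part.eq_some_iff.2 this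
  refine ⟨fun n => by rw [hq']; trivial, q n₀, n₀, ?_, fun n hn => ?_⟩
  · rw [(hn₀ n₀ le_rfl).2, hTL, hDL]
  · rw [hq', (hn₀ (t n) (hn.trans (ht n))).1]

theorem exists_monotone_of_subset {L : Set ℕ} {D : Finset ℕ} (hD : ↑D ⊆ L) :
    ∃ F : ℕ → Finset ℕ, Monotone F ∧ (⋃ n, (F n : Set ℕ)) = L ∧ F 0 = D := by
  classical
  refine ⟨fun n => D ∪ (Finset.range n).filter (· ∈ L), fun m n hmn => ?_, ?_, by simp⟩
  · exact Finset.union_subset_union subset_rfl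
      (Finset.filter_subset_filter _ (Finset.range_mono hmn))
  · refine subset_antisymm (Set.iUnion_subset fun n => ?_) fun x hx => ?_
    · simp only [Finset.coe_union, Set.union_subset_iff]
      exact ⟨hD, fun x hx => (Finset.mem_filter.1 hx).2⟩
    · exact Set.mem_iUnion.2 ⟨x + 1, by simp [hx]⟩

theorem Learns.dom {φ : ℕ → ℕ →. ℕ} {h : ℕ →. ℕ} {L : Set ℕ} (hL : Learns Sd (Ex φ) h L)
    {D : Finset ℕ} (hD : ↑D ⊆ L) : (h (finsetCode D)).Dom := by
  obtain ⟨F, hF, hFL, rfl⟩ := exists_monotone_of_subset hD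
  exact (hL.exists_limit hF hFL).1 0

/-- Convergence on exhaustions yields a locking set, hence a base E. An exhaustion starting at E
stays inside the range of stability, so its limit is already the value at E. -/
theorem Learns.exists_isBase {φ : ℕ → ℕ →. ℕ} {h : ℕ →. ℕ} {L : Set ℕ}
    (hL : Learns Sd (Ex φ) h L) :
    ∃ E v, IsBase (fun D => h (finsetCode D)) E L ∧ h (finsetCode E) = Part.some v ∧
      W φ v = L := by
  obtain ⟨D₀, hD₀, hs⟩ := exists_stableOn_of_eventually_const (H := fun D => h (finsetCode D))
    (S := L) fun D hD hDL => by
      obtain ⟨-, v, n₀, -, hn₀⟩ := hL.exists_limit hD hDL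
      exact ⟨n₀, fun n hn => by simp only [hn₀ n hn, hn₀ n₀ le_rfl]⟩
  obtain ⟨E, hE⟩ := exists_isBase_of_stableOn hD₀ hs
  obtain ⟨F, hF, hFL, hF0⟩ := exists_monotone_of_subset hE.isInitial.1
  obtain ⟨-, v, n₀, hv, hn₀⟩ := hL.exists_limit hF hFL
  refine ⟨E, v, hE, ?_, hv⟩
  have := hE.stableOn (F n₀) (hF0 ▸ hF (Nat.zero_le _)) (hFL ▸ Set.subset_iUnion (fun n => (F n : Set ℕ)) n₀)
  rw [← hn₀ n₀ le_rfl]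
  exact this.symm

end Texts

/-! ### Canonical indices and step-bounded approximation -/

section Codes

/-- The finite set with canonical index `n`. -/
def codedSet (n : ℕ) : Finset ℕ := n.bitIndices.toFinset

theorem mem_codedSet {n i : ℕ} : i ∈ codedSet n ↔ n.testBit i = true := by
  simp [codedSet]

@[simp] theorem codedSet_finsetCode (D : Finset ℕ) : codedSet (finsetCode D) = D :=
  Finset.toFinset_bitIndices_sum_two_pow D

@[simp] theorem finsetCode_codedSet (n : ℕ) : finsetCode (codedSet n) = n :=
  Finset.sum_toFinset_bitIndices_two_pow n

theorem finsetCode_mono {D D' : Finset ℕ} (h : D ⊆ D') : finsetCode D ≤ finsetCode D' :=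
  Finset.sum_le_sum_of_subset h

theorem lt_finsetCode {D : Finset ℕ} {x : ℕ} (hx : x ∈ D) : x < finsetCode D :=
  Finset.lt_geomSum_of_mem le_rfl hx

theorem lt_two_pow_iff {n m : ℕ} : n < 2 ^ m ↔ ∀ x ∈ codedSet n, x < m := by
  refine ⟨fun h x hx => ?_, fun h => Nat.lt_pow_two_of_testBit n fun i hi => ?_⟩
  · by_contra! hm
    have := mem_codedSet.1 hx
    rw [Nat.testBit_lt_two_pow (h.trans_le (Nat.pow_le_pow_right two_pos hm))] at this
    exact absurd this (by simp)
  · by_contra hne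
    exact absurd (h i (mem_codedSet.2 (by simpa using hne))) (not_lt.2 hi)

theorem codedSet_mod_two_pow (n m : ℕ) :
    codedSet (n % 2 ^ m) = (codedSet n).filter (· < m) := by
  ext x
  simp [mem_codedSet, Nat.testBit_mod_two_pow, and_comm]

theorem primrec_two_pow : Primrec fun n : ℕ => 2 ^ n :=
  (Primrec.nat_rec₁ 1 (Primrec.nat_double.comp Primrec.snd).to₂).of_eq fun n => by
    induction n with
    | zero => rfl
    | succ n ih => rw [pow_succ, ← ih, mul_comm]

theorem primrecRel_mem_codedSet : PrimrecRel fun n i : ℕ => i ∈ codedSet n := by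
  refine (Primrec.eq.comp (Primrec.nat_mod.comp (Primrec.nat_div.comp Primrec.fst
    (primrec_two_pow.comp Primrec.snd)) (Primrec.const 2)) (Primrec.const 1)).of_eq ?_
  rintro ⟨n, i⟩
  simp [mem_codedSet, Nat.testBit_eq_decide_div_mod_eq]

theorem _root_.PrimrecPred.forall_lt_comp {α : Type*} [Primcodable α] {p : α × ℕ → Prop}
    {f : α → ℕ} (hp : PrimrecPred p) (hf : Primrec f) :
    PrimrecPred fun a => ∀ x < f a, p (a, x) :=
  ((PrimrecRel.forall_mem_list (R := fun x a => p (a, x))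
    (hp.comp (Primrec.snd.pair Primrec.fst))).comp (Primrec.list_range.comp hf)
      Primrec.id).of_eq fun a => by simp

theorem _root_.PrimrecPred.imp {α : Type*} [Primcodable α] {p q : α → Prop}
    (hp : PrimrecPred p) (hq : PrimrecPred q) : PrimrecPred fun a => p a → q a := by
  classical exact (hp.not.or hq).of_eq fun a => by tauto

theorem forall_mem_codedSet_iff {n : ℕ} {p : ℕ → Prop} :
    (∀ x < n, x ∈ codedSet n → p x) ↔ ∀ x ∈ codedSet n, p x :=
  ⟨fun h x hx => h x (by simpa using lt_finsetCode hx) hx, fun h x _ hx => h x hx⟩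

theorem primrecRel_codedSet_subset : PrimrecRel fun n m : ℕ => codedSet n ⊆ codedSet m := by
  refine PrimrecPred.of_eq (PrimrecPred.forall_lt_comp (f := fun a : ℕ × ℕ => a.1)
    (p := fun b => b.2 ∈ codedSet b.1.1 → b.2 ∈ codedSet b.1.2) (.imp ?_ ?_) Primrec.fst) ?_
  · exact primrecRel_mem_codedSet.comp (Primrec.fst.comp Primrec.fst) Primrec.snd
  · exact primrecRel_mem_codedSet.comp (Primrec.snd.comp Primrec.fst) Primrec.snd
  · rintro ⟨n, m⟩
    exact forall_mem_codedSet_iff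

/-- Partial computable functions are limits of primitive recursive approximations. -/
theorem _root_.Nat.Partrec.exists_approx {h : ℕ →. ℕ} (hh : Nat.Partrec h) :
    ∃ a : ℕ → ℕ → Option ℕ, Primrec₂ a ∧ (∀ k l n v, k ≤ l → a k n = some v → a l n = some v) ∧
      ∀ n v, v ∈ h n ↔ ∃ k, a k n = some v := by
  obtain ⟨c, rfl⟩ := Nat.Partrec.Code.exists_code.1 hh
  refine ⟨fun k n => Nat.Partrec.Code.evaln k c n, ?_, fun k l n v hkl h =>
    Nat.Partrec.Code.evaln_mono hkl h, fun n v => Nat.Partrec.Code.evaln_complete⟩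
  exact Nat.Partrec.Code.primrec_evaln.comp
    ((Primrec.fst.pair (Primrec.const c)).pair Primrec.snd)

end Codes

/-! ### Computing the base of finite data -/

section Scan

variable {a : ℕ → ℕ → Option ℕ}

/-- Within `k` steps `E` appears to be stable on `F` (canonical indices). -/
def StableApprox (a : ℕ → ℕ → Option ℕ) (k E F : ℕ) : Prop :=
  ∀ d < F + 1, codedSet d ⊆ codedSet F → codedSet E ⊆ codedSet d → a k d = a k E

theorem primrecPred_stableApprox (ha : Primrec₂ a) :
    PrimrecPred fun b : ℕ × ℕ × ℕ => StableApprox a b.1 b.2.1 b.2.2 := by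
  refine PrimrecPred.forall_lt_comp (f := fun b : ℕ × ℕ × ℕ => b.2.2 + 1)
    (p := fun c : (ℕ × ℕ × ℕ) × ℕ => codedSet c.2 ⊆ codedSet c.1.2.2 →
      codedSet c.1.2.1 ⊆ codedSet c.2 → a c.1.1 c.2 = a c.1.1 c.1.2.1)
    (.imp ?_ (.imp ?_ ?_)) (Primrec.succ.comp (Primrec.snd.comp Primrec.snd))
  · exact primrecRel_codedSet_subset.comp Primrec.snd
      (Primrec.snd.comp (Primrec.snd.comp Primrec.fst))
  · exact primrecRel_codedSet_subset.comp (Primrec.fst.comp (Primrec.snd.comp Primrec.fst))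
      Primrec.snd
  · exact Primrec.eq.comp (ha.comp (Primrec.fst.comp Primrec.fst) Primrec.snd)
      (ha.comp (Primrec.fst.comp Primrec.fst) (Primrec.fst.comp (Primrec.snd.comp Primrec.fst)))

open Classical in
/-- The index of the base of `D ∩ [0, n)` as computed with `k` steps for each value. -/
noncomputable def scan (a : ℕ → ℕ → Option ℕ) (k D n : ℕ) : ℕ :=
  Nat.rec 0 (fun n E => if StableApprox a k E (D % 2 ^ (n + 1)) then E else D % 2 ^ (n + 1)) n

theorem primrec_scan (ha : Primrec₂ a) : Primrec₂ fun k D : ℕ => scan a k D D := by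
  classical
  have hmod : Primrec fun p : (ℕ × ℕ) × ℕ × ℕ => p.1.2 % 2 ^ (p.2.1 + 1) :=
    Primrec.nat_mod.comp (Primrec.snd.comp Primrec.fst)
      (primrec_two_pow.comp (Primrec.succ.comp (Primrec.fst.comp Primrec.snd)))
  exact Primrec.nat_rec' (f := fun p : ℕ × ℕ => p.2) (g := fun _ => 0)
    (h := fun p q => if StableApprox a p.1 q.2 (p.2 % 2 ^ (q.1 + 1)) then q.2
      else p.2 % 2 ^ (q.1 + 1)) Primrec.snd (Primrec.const 0)
    (Primrec.ite ((primrecPred_stableApprox ha).comp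
      ((Primrec.fst.comp Primrec.fst).pair ((Primrec.snd.comp Primrec.snd).pair hmod)))
      (Primrec.snd.comp Primrec.snd) hmod)

/-- All values on subsets of `D` are known within `k` steps. -/
def Known (a : ℕ → ℕ → Option ℕ) (D k : ℕ) : Prop :=
  ∀ d < D + 1, codedSet d ⊆ codedSet D → a k d ≠ none

theorem primrecRel_known (ha : Primrec₂ a) : PrimrecRel (Known a) := by
  refine PrimrecPred.forall_lt_comp (f := fun b : ℕ × ℕ => b.1 + 1)
    (p := fun c : (ℕ × ℕ) × ℕ => codedSet c.2 ⊆ codedSet c.1.1 → a c.1.2 c.2 ≠ none)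
    (.imp ?_ (PrimrecPred.not ?_)) (Primrec.succ.comp Primrec.fst)
  · exact primrecRel_codedSet_subset.comp Primrec.snd (Primrec.fst.comp Primrec.fst)
  · exact Primrec.eq.comp (ha.comp (Primrec.snd.comp Primrec.fst) Primrec.snd)
      (Primrec.const none)

variable {h : ℕ →. ℕ}

theorem codedSet_le {d D : ℕ} (hd : codedSet d ⊆ codedSet D) : d ≤ D := by
  simpa using finsetCode_mono hd

theorem exists_known (hmono : ∀ k l n v, k ≤ l → a k n = some v → a l n = some v)
    (hh : ∀ n v, v ∈ h n ↔ ∃ k, a k n = some v) {D : ℕ}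
    (hD : ∀ d, codedSet d ⊆ codedSet D → (h d).Dom) : ∃ k, Known a D k := by
  have : ∀ N, ∃ k, ∀ d < N, codedSet d ⊆ codedSet D → a k d ≠ none := by
    intro N
    induction N with
    | zero => exact ⟨0, fun d hd => absurd hd (Nat.not_lt_zero d)⟩
    | succ N ih =>
      obtain ⟨k, hk⟩ := ih
      have lift : ∀ l ≥ k, ∀ d < N, codedSet d ⊆ codedSet D → a l d ≠ none :=
        fun l hl d hd hdD => by
          obtain ⟨v, hv⟩ := Option.ne_none_iff_exists'.1 (hk d hd hdD)
          simp [hmono k l d v hl hv]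
      by_cases hN : codedSet N ⊆ codedSet D
      · obtain ⟨l, hl⟩ := (hh N _).1 (Part.get_mem (hD N hN))
        refine ⟨max k l, fun d hd hdD => ?_⟩
        rcases Nat.lt_succ_iff_lt_or_eq.1 hd with hd | rfl
        · exact lift _ (le_max_left _ _) d hd hdD
        · simp [hmono l _ d _ (le_max_right k l) hl]
      · refine ⟨k, fun d hd hdD => ?_⟩
        rcases Nat.lt_succ_iff_lt_or_eq.1 hd with hd | rfl
        · exact hk d hd hdD
        · exact absurd hdD hN
  exact this _

theorem Known.eq_iff (hh : ∀ n v, v ∈ h n ↔ ∃ k, a k n = some v) {D k : ℕ} (hk : Known a D k)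
    {d e : ℕ} (hd : codedSet d ⊆ codedSet D) (he : codedSet e ⊆ codedSet D) :
    a k d = a k e ↔ h d = h e := by
  have key : ∀ d, codedSet d ⊆ codedSet D → ∃ v, a k d = some v ∧ h d = Part.some v :=
    fun d hd => by
      obtain ⟨v, hv⟩ := Option.ne_none_iff_exists'.1 (hk d (Nat.lt_succ_of_le (codedSet_le hd)) hd)
      exact ⟨v, hv, Part.eq_some_iff.2 ((hh d v).2 ⟨k, hv⟩)⟩
  obtain ⟨v, hv, hv'⟩ := key d hd
  obtain ⟨w, hw, hw'⟩ := key e he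
  rw [hv, hw, hv', hw', Option.some_inj, Part.some_inj]

theorem Known.stableApprox_iff (hh : ∀ n v, v ∈ h n ↔ ∃ k, a k n = some v) {D k : ℕ}
    (hk : Known a D k) {E F : ℕ} (hF : codedSet F ⊆ codedSet D) (hEF : codedSet E ⊆ codedSet F) :
    StableApprox a k E F ↔
      StableOn (fun D => h (finsetCode D)) (codedSet E) (codedSet F) := by
  constructor
  · intro hs G hEG hGF
    have hGF' : codedSet (finsetCode G) ⊆ codedSet F := by
      simpa using Finset.coe_subset.1 hGF
    have := hs (finsetCode G) (Nat.lt_succ_of_le (codedSet_le hGF')) hGF' (by simpa using hEG)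
    simpa using (hk.eq_iff hh (hGF'.trans hF) (hEF.trans hF)).1 this
  · intro hs d _ hdF hEd
    rw [hk.eq_iff hh (hdF.trans hF) (hEF.trans hF)]
    simpa using hs (codedSet d) hEd (Finset.coe_subset.2 hdF)

/-- When all relevant values are known, the approximate stability test is exact, and the scan either
keeps the old base or restarts from the whole segment read so far. -/
theorem Known.isBase_scan (hh : ∀ n v, v ∈ h n ↔ ∃ k, a k n = some v) {D k : ℕ}
    (hk : Known a D k) (n : ℕ) :
    IsBase (fun D => h (finsetCode D)) (codedSet (scan a k D n))
      ((codedSet D).filter (· < n) : Finset ℕ) := by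
  induction n with
  | zero => simpa [scan, codedSet] using isBase_empty (fun D => h (finsetCode D))
  | succ n ih =>
    have hsub : codedSet (D % 2 ^ (n + 1)) ⊆ codedSet D := by
      rw [codedSet_mod_two_pow]; exact Finset.filter_subset _ _
    have hE : codedSet (scan a k D n) ⊆ codedSet (D % 2 ^ (n + 1)) := by
      rw [codedSet_mod_two_pow]
      exact Finset.coe_subset.1 (ih.isInitial.1.trans (isInitial_filter_lt_succ _ n).1)
    have hiff := hk.stableApprox_iff hh hsub hE
    rw [codedSet_mod_two_pow] at hiff
    by_cases hs : StableApprox a k (scan a k D n) (D % 2 ^ (n + 1))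
    · have : scan a k D (n + 1) = scan a k D n := if_pos hs
      rw [this]
      exact ih.filter_lt_succ_of_stableOn (hiff.1 hs)
    · have : scan a k D (n + 1) = D % 2 ^ (n + 1) := if_neg hs
      rw [this, codedSet_mod_two_pow]
      exact ih.filter_lt_succ_of_not_stableOn (mt hiff.2 hs)

theorem Known.isBase (hh : ∀ n v, v ∈ h n ↔ ∃ k, a k n = some v) {D k : ℕ}
    (hk : Known a D k) :
    IsBase (fun D => h (finsetCode D)) (codedSet (scan a k D D)) (codedSet D) := by
  have := hk.isBase_scan hh D
  rwa [Finset.filter_true_of_mem fun x hx => by simpa using lt_finsetCode hx] at this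

end Scan

/-! ### The trimmed conjecture of a base -/

section Conjecture

/-- Elements above `E` that are enumerated within `s` steps by the hypothesis on `E`. -/
def Listed (a : ℕ → ℕ → Option ℕ) (w : ℕ → ℕ → Option ℕ) (E k s y : ℕ) : Prop :=
  E < 2 ^ y ∧ y < s ∧ w s (Nat.pair ((a k E).getD 0) y) ≠ none

/-- Within `k` steps, the hypothesis on `E` is seen to persist on all sets between `E` and its
extension by the elements listed in `s` steps. -/
def Persists (a : ℕ → ℕ → Option ℕ) (w : ℕ → ℕ → Option ℕ) (E k s : ℕ) : Prop :=
  a k E ≠ none ∧ ∀ d < 2 ^ (E + s), codedSet E ⊆ codedSet d →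
    (∀ y < d, y ∈ codedSet d → y ∈ codedSet E ∨ Listed a w E k s y) → a k d = a k E

/-- `x` enters the conjecture based on `E` at stage `n`, a pair of step bounds. -/
def Enters (a : ℕ → ℕ → Option ℕ) (w : ℕ → ℕ → Option ℕ) (E x n : ℕ) : Prop :=
  x ∈ codedSet E ∨ Listed a w E n.unpair.1 n.unpair.2 x ∧ Persists a w E n.unpair.1 n.unpair.2

/-- The language conjectured on the base with index `E`. -/
def conjecture (a : ℕ → ℕ → Option ℕ) (w : ℕ → ℕ → Option ℕ) (E : ℕ) : Set ℕ :=
  {x | ∃ n, Enters a w E x n}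

variable {a w : ℕ → ℕ → Option ℕ}

theorem primrecPred_listed (ha : Primrec₂ a) (hw : Primrec₂ w) :
    PrimrecPred fun b : (ℕ × ℕ × ℕ) × ℕ => Listed a w b.1.1 b.1.2.1 b.1.2.2 b.2 := by
  have hE : Primrec fun b : (ℕ × ℕ × ℕ) × ℕ => b.1.1 := Primrec.fst.comp Primrec.fst
  have hk : Primrec fun b : (ℕ × ℕ × ℕ) × ℕ => b.1.2.1 :=
    Primrec.fst.comp (Primrec.snd.comp Primrec.fst)
  have hs : Primrec fun b : (ℕ × ℕ × ℕ) × ℕ => b.1.2.2 :=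
    Primrec.snd.comp (Primrec.snd.comp Primrec.fst)
  refine .and (Primrec.nat_lt.comp hE (primrec_two_pow.comp Primrec.snd))
    (.and (Primrec.nat_lt.comp Primrec.snd hs) (PrimrecPred.not ?_))
  exact Primrec.eq.comp (hw.comp hs (Primrec₂.natPair.comp
    (Primrec.option_getD.comp (ha.comp hk hE) (Primrec.const 0)) Primrec.snd))
    (Primrec.const none)

theorem primrecPred_persists (ha : Primrec₂ a) (hw : Primrec₂ w) :
    PrimrecPred fun b : ℕ × ℕ × ℕ => Persists a w b.1 b.2.1 b.2.2 := by
  have hE : Primrec fun b : (ℕ × ℕ × ℕ) × ℕ => b.1.1 := Primrec.fst.comp Primrec.fst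
  have hk : Primrec fun b : (ℕ × ℕ × ℕ) × ℕ => b.1.2.1 :=
    Primrec.fst.comp (Primrec.snd.comp Primrec.fst)
  refine .and (PrimrecPred.not (Primrec.eq.comp
    (ha.comp (Primrec.fst.comp Primrec.snd) Primrec.fst) (Primrec.const none))) ?_
  refine PrimrecPred.forall_lt_comp (f := fun b : ℕ × ℕ × ℕ => 2 ^ (b.1 + b.2.2))
    (p := fun c : (ℕ × ℕ × ℕ) × ℕ => codedSet c.1.1 ⊆ codedSet c.2 →
      (∀ y < c.2, y ∈ codedSet c.2 → y ∈ codedSet c.1.1 ∨ Listed a w c.1.1 c.1.2.1 c.1.2.2 y) →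
        a c.1.2.1 c.2 = a c.1.2.1 c.1.1)
    (.imp (primrecRel_codedSet_subset.comp hE Primrec.snd) (.imp ?_
      (Primrec.eq.comp (ha.comp hk Primrec.snd) (ha.comp hk hE))))
    (primrec_two_pow.comp (Primrec.nat_add.comp Primrec.fst (Primrec.snd.comp Primrec.snd)))
  refine PrimrecPred.forall_lt_comp (f := fun c : (ℕ × ℕ × ℕ) × ℕ => c.2)
    (p := fun d : ((ℕ × ℕ × ℕ) × ℕ) × ℕ => d.2 ∈ codedSet d.1.2 →
      d.2 ∈ codedSet d.1.1.1 ∨ Listed a w d.1.1.1 d.1.1.2.1 d.1.1.2.2 d.2)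
    (.imp (primrecRel_mem_codedSet.comp (Primrec.snd.comp Primrec.fst) Primrec.snd)
      (.or (primrecRel_mem_codedSet.comp (hE.comp Primrec.fst) Primrec.snd) ?_)) Primrec.snd
  exact (primrecPred_listed ha hw).comp ((Primrec.fst.comp Primrec.fst).pair Primrec.snd)

theorem primrecPred_enters (ha : Primrec₂ a) (hw : Primrec₂ w) :
    PrimrecPred fun b : (ℕ × ℕ) × ℕ => Enters a w b.1.1 b.1.2 b.2 := by
  have hE : Primrec fun b : (ℕ × ℕ) × ℕ => b.1.1 := Primrec.fst.comp Primrec.fst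
  have hx : Primrec fun b : (ℕ × ℕ) × ℕ => b.1.2 := Primrec.snd.comp Primrec.fst
  have ht : Primrec fun b : (ℕ × ℕ) × ℕ => (b.1.1, b.2.unpair.1, b.2.unpair.2) :=
    hE.pair (Primrec.unpair.comp Primrec.snd)
  exact .or (primrecRel_mem_codedSet.comp hE hx)
    (.and ((primrecPred_listed ha hw).comp (ht.pair hx)) ((primrecPred_persists ha hw).comp ht))

variable {h : ℕ →. ℕ}

/-- The condition `E < 2 ^ y` in `Listed` says that y exceeds every element of `codedSet E`. -/
theorem isInitial_conjecture (E : ℕ) : IsInitial (codedSet E) (conjecture a w E) := by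
  refine ⟨fun x hx => ⟨0, Or.inl hx⟩, ?_⟩
  rintro x ⟨n, hx | ⟨⟨hEx, -⟩, -⟩⟩ e he hxe
  · exact hx
  · exact absurd (lt_two_pow_iff.1 hEx e he) (not_lt.2 hxe)

theorem Persists.stableOn (hh : ∀ n v, v ∈ h n ↔ ∃ k, a k n = some v) {E k s : ℕ}
    (hp : Persists a w E k s) :
    StableOn (fun D => h (finsetCode D)) (codedSet E)
      {y | y ∈ codedSet E ∨ Listed a w E k s y} := by
  intro D hED hD
  obtain ⟨v, hv⟩ := Option.ne_none_iff_exists'.1 hp.1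
  -- Elements of the base are smaller than its index E, and listed ones smaller than s. The bound `2
  -- ^ (E + s)` thus covers every set to be tested.
  have hDv := hp.2 (finsetCode D) (lt_two_pow_iff.2 fun x hx => ?_) (by simpa using hED)
    fun y _ hy => hD (by simpa using hy)
  · rw [hv] at hDv
    simp only [finsetCode_codedSet]
    rw [Part.eq_some_iff.2 ((hh E v).2 ⟨k, hv⟩),
      Part.eq_some_iff.2 ((hh (finsetCode D) v).2 ⟨k, hDv⟩)]
  · rw [codedSet_finsetCode] at hx
    rcases hD hx with hx | ⟨-, hx, -⟩
    · have := lt_finsetCode hx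
      simp only [finsetCode_codedSet] at this
      omega
    · omega

theorem eq_of_ne_none (hmono : ∀ k l n v, k ≤ l → a k n = some v → a l n = some v)
    {k l n : ℕ} (hk : a k n ≠ none) (hl : a l n ≠ none) : a k n = a l n := by
  obtain ⟨v, hv⟩ := Option.ne_none_iff_exists'.1 hk
  obtain ⟨u, hu⟩ := Option.ne_none_iff_exists'.1 hl
  rw [hv, hu, ← hmono k _ n v (le_max_left k l) hv, hmono l _ n u (le_max_right k l) hu]

theorem Listed.mono (hw : ∀ k l n v, k ≤ l → w k n = some v → w l n = some v) {E k l s t y : ℕ}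
    (hy : Listed a w E k s y) (hst : s ≤ t) (hkl : a k E = a l E) : Listed a w E l t y := by
  obtain ⟨h1, h2, h3⟩ := hy
  obtain ⟨v, hv⟩ := Option.ne_none_iff_exists'.1 h3
  refine ⟨h1, h2.trans_le hst, ?_⟩
  rw [← hkl, hw s t _ v hst hv]
  simp

/-- Listed sets grow with s and do not depend on k once the value at E is known. A finite part of
the conjecture therefore fits into a single stage whose persistence has been verified. -/
theorem stableOn_conjecture (hmono : ∀ k l n v, k ≤ l → a k n = some v → a l n = some v)
    (hw : ∀ k l n v, k ≤ l → w k n = some v → w l n = some v)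
    (hh : ∀ n v, v ∈ h n ↔ ∃ k, a k n = some v) (E : ℕ) :
    StableOn (fun D => h (finsetCode D)) (codedSet E) (conjecture a w E) := by
  classical
  have key : ∀ D : Finset ℕ, ↑D ⊆ conjecture a w E → D ⊆ codedSet E ∨
      ∃ k s, Persists a w E k s ∧ ∀ y ∈ D, y ∈ codedSet E ∨ Listed a w E k s y := by
    intro D
    induction D using Finset.induction_on with
    | empty => exact fun _ => Or.inl (Finset.empty_subset _)
    | insert x D _ ih =>
      intro hD
      rw [Finset.coe_insert, Set.insert_subset_iff] at hD
      obtain ⟨⟨n, hx⟩, hD⟩ := hD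
      rcases hx with hx | ⟨hx, hp⟩
      · rcases ih hD with h1 | ⟨k, s, hp, h1⟩
        · exact Or.inl (Finset.insert_subset hx h1)
        · refine Or.inr ⟨k, s, hp, fun y hy => ?_⟩
          rcases Finset.mem_insert.1 hy with rfl | hy
          · exact Or.inl hx
          · exact h1 y hy
      · right
        rcases ih hD with h1 | ⟨k, s, hp', h1⟩
        · refine ⟨_, _, hp, fun y hy => ?_⟩
          rcases Finset.mem_insert.1 hy with rfl | hy
          · exact Or.inr hx
          · exact Or.inl (h1 hy)
        · have heq : a n.unpair.1 E = a k E := eq_of_ne_none hmono hp.1 hp'.1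
          rcases le_total s n.unpair.2 with hle | hle
          · refine ⟨_, _, hp, fun y hy => ?_⟩
            rcases Finset.mem_insert.1 hy with rfl | hy
            · exact Or.inr hx
            · exact (h1 y hy).imp_right fun h => h.mono hw hle heq.symm
          · refine ⟨_, _, hp', fun y hy => ?_⟩
            rcases Finset.mem_insert.1 hy with rfl | hy
            · exact Or.inr (hx.mono hw hle heq)
            · exact h1 y hy
  intro D hED hD
  rcases key D hD with h1 | ⟨k, s, hp, h1⟩
  · rw [subset_antisymm h1 hED]
  · exact hp.stableOn hh D hED h1

theorem conjecture_eq (hmono : ∀ k l n v, k ≤ l → a k n = some v → a l n = some v)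
    (hw : ∀ k l n v, k ≤ l → w k n = some v → w l n = some v)
    (hh : ∀ n v, v ∈ h n ↔ ∃ k, a k n = some v) {E v : ℕ} {L : Set ℕ}
    (hE : IsBase (fun D => h (finsetCode D)) (codedSet E) L) (hv : h E = Part.some v)
    (hL : ∀ x, x ∈ L ↔ ∃ s, w s (Nat.pair v x) ≠ none) : conjecture a w E = L := by
  have hval : ∀ k, a k E ≠ none → a k E = some v := fun k hk => by
    obtain ⟨u, hu⟩ := Option.ne_none_iff_exists'.1 hk
    have : u ∈ h E := (hh E u).2 ⟨k, hu⟩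
    rw [hv, Part.mem_some_iff] at this
    rw [hu, this]
  have hlisted : ∀ k s y, a k E = some v → Listed a w E k s y → y ∈ L := fun k s y hk hy => by
    have := hy.2.2
    rw [hk] at this
    exact (hL y).2 ⟨s, this⟩
  refine subset_antisymm ?_ fun x hx => ?_
  · rintro x ⟨n, hx | ⟨hx, hp⟩⟩
    · exact hE.isInitial.1 hx
    -- `Persists` demands a known value at E, so the default 0 in `Listed` never contributes.
    · exact hlisted _ _ x (hval _ hp.1) hx
  · by_cases hxE : x ∈ codedSet E
    · exact ⟨0, Or.inl hxE⟩
    obtain ⟨s₀, hs₀⟩ := (hL x).1 hx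
    obtain ⟨u, hu⟩ := Option.ne_none_iff_exists'.1 hs₀
    -- This s suffices to enumerate x and meets the requirement x < s in `Listed`.
    set s := max s₀ (x + 1) with hs
    obtain ⟨k₀, hk₀⟩ := (hh E v).1 (hv ▸ Part.mem_some v)
    let P : ℕ → Prop := fun d => codedSet E ⊆ codedSet d ∧
      ∀ y ∈ codedSet d, y ∈ codedSet E ∨ Listed a w E k₀ s y
    have hP : ∀ d, P d → v ∈ h d := by
      rintro d ⟨h1, h2⟩
      have := hE.stableOn (codedSet d) h1 fun y hy =>
        (h2 y hy).elim (fun h => hE.isInitial.1 h) (hlisted k₀ s y hk₀)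
      simp only [finsetCode_codedSet] at this
      rw [this, hv]
      exact Part.mem_some v
    -- `P` is fixed at k₀, so the sets to be tested do not change as k grows. They are finitely
    -- many, and one k confirms the value v on all of them.
    obtain ⟨k, hkk, hk⟩ : ∃ k ≥ k₀, ∀ d < 2 ^ (E + s), P d → a k d = some v := by
      generalize 2 ^ (E + s) = N
      induction N with
      | zero => exact ⟨k₀, le_rfl, fun d hd => absurd hd (Nat.not_lt_zero d)⟩
      | succ N ih =>
        obtain ⟨k, hkk, hk⟩ := ih
        by_cases hN : P N
        · obtain ⟨l, hl⟩ := (hh N v).1 (hP N hN)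
          refine ⟨max k l, hkk.trans (le_max_left _ _), fun d hd hPd => ?_⟩
          rcases Nat.lt_succ_iff_lt_or_eq.1 hd with hd | rfl
          · exact hmono k _ d v (le_max_left _ _) (hk d hd hPd)
          · exact hmono l _ d v (le_max_right _ _) hl
        · refine ⟨k, hkk, fun d hd hPd => ?_⟩
          rcases Nat.lt_succ_iff_lt_or_eq.1 hd with hd | rfl
          · exact hk d hd hPd
          · exact absurd hPd hN
    have hkE : a k E = some v := hmono k₀ k E v hkk hk₀
    refine ⟨Nat.pair k s, Or.inr ?_⟩
    simp only [Nat.unpair_pair]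
    refine ⟨⟨lt_two_pow_iff.2 fun e he => ?_, by omega, ?_⟩, by simp [hkE], fun d hd hEd hdL => ?_⟩
    · by_contra! hle
      exact hxE (hE.isInitial.2 x hx e he hle)
    · rw [hkE]
      simp [hw s₀ s _ u (le_max_left _ _) hu]
    · rw [hkE]
      refine hk d hd ⟨hEd, fun y hy => ?_⟩
      exact (forall_mem_codedSet_iff.1 hdL y hy).imp_right fun h =>
        h.mono hw le_rfl (hkE.trans hk₀.symm)

theorem exists_index_conjecture {φ : ℕ → ℕ →. ℕ} (hφ : IsAcceptable φ) (ha : Primrec₂ a)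
    (hw : Primrec₂ w) : ∃ f : ℕ → ℕ, Computable f ∧ ∀ E, W φ (f E) = conjecture a w E := by
  classical
  obtain ⟨f, hf, hfφ⟩ := hφ.2 (fun E x => Nat.rfind fun n => Part.some (decide (Enters a w E x n)))
    (Partrec.rfind (Primrec.to_comp (primrecPred_enters ha hw).decide).partrec)
  refine ⟨f, hf, fun E => Set.ext fun x => ?_⟩
  rw [W, hfφ]
  exact Nat.rfind_dom.trans (by simp [conjecture])

end Conjecture

/-! ### The learner and its restrictions -/

section Learner

open Classical in
/-- The learner that conjectures the language of the base of the data. -/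
noncomputable def baseLearner (a : ℕ → ℕ → Option ℕ) (f : ℕ → ℕ) : ℕ →. ℕ := fun D =>
  (Nat.rfind fun k => Part.some (decide (Known a D k))).map fun k => f (scan a k D D)

variable {a : ℕ → ℕ → Option ℕ}

theorem partrec_baseLearner (ha : Primrec₂ a) {f : ℕ → ℕ} (hf : Computable f) :
    Nat.Partrec (baseLearner a f) := by
  classical
  exact Partrec.nat_iff.1 (Partrec.map
    (Partrec.rfind (Primrec.to_comp (primrecRel_known ha).decide).partrec)
    (hf.comp ((primrec_scan ha).to_comp.comp Computable.snd Computable.fst)))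

theorem exists_isBase_mem_baseLearner {h : ℕ →. ℕ} {f : ℕ → ℕ}
    (hmono : ∀ k l n v, k ≤ l → a k n = some v → a l n = some v)
    (hh : ∀ n v, v ∈ h n ↔ ∃ k, a k n = some v) {D : Finset ℕ}
    (hD : ∀ D' ⊆ D, (h (finsetCode D')).Dom) :
    ∃ E, IsBase (fun D => h (finsetCode D)) (codedSet E) D ∧
      f E ∈ baseLearner a f (finsetCode D) := by
  classical
  obtain ⟨k, hk⟩ := exists_known hmono hh (D := finsetCode D) fun d hd => by
    simpa using hD (codedSet d) (by simpa using hd)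
  obtain ⟨l, hl, -⟩ := Nat.rfind_min' (p := fun k => decide (Known a (finsetCode D) k))
    (decide_eq_true hk)
  have hl' : Known a (finsetCode D) l := by
    simpa using Nat.rfind_spec hl
  exact ⟨_, by simpa using hl'.isBase hh, Part.mem_map _ hl⟩

end Learner

/-- Growing data whose bases are conjectured by sets in which the bases are initial and stable lead
to conservative, strongly decisive and cautious convergence. -/
theorem restrictions_of_isBase {φ : ℕ → ℕ →. ℕ} {α : Type*} {H : Finset ℕ → α} {f : ℕ → ℕ}
    (hf : ∀ E, IsInitial (codedSet E) (W φ (f E)) ∧ StableOn H (codedSet E) (W φ (f E)))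
    {p : ℕ →. ℕ} {T : Text} {e : ℕ → ℕ} (hp : ∀ i, f (e i) ∈ p i)
    (he : ∀ i, IsBase H (codedSet (e i)) (contentInit T i)) {E : ℕ}
    (hE : IsBase H (codedSet E) (content T)) (hW : W φ (f E) = content T) :
    Conv φ p T ∧ SDec φ p T ∧ Caut φ p T ∧ Ex φ p T := by
  have inj : ∀ {m n}, codedSet m = codedSet n → m = n := fun {m n} h => by
    rw [← finsetCode_codedSet m, h, finsetCode_codedSet]
  have hmono : ∀ {i j}, i ≤ j → (contentInit T i : Set ℕ) ⊆ contentInit T j :=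
    fun h => Finset.coe_subset.2 (contentInit_mono T h)
  -- All three restrictions reduce to this: a conjecture that contains the base of later data has
  -- that same base.
  have key : ∀ i j, i ≤ j → ↑(codedSet (e j)) ⊆ W φ (f (e i)) → e i = e j := fun i j hij h =>
    inj ((he i).eq_of_subset (he j) (hmono hij) (hf (e i)).1 (hf (e i)).2 h)
  refine ⟨⟨_, hp, fun i hi => ?_⟩, ⟨_, hp, fun i j k hijk => ?_⟩, ⟨_, hp, fun i j hij => ?_⟩,
    ⟨_, hp, ?_⟩⟩
  · exact congrArg f (key i (i + 1) i.le_succ ((he (i + 1)).isInitial.1.trans hi))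
  · obtain ⟨hij, hjk, hik⟩ := hijk
    have hek := key i k (hij.trans hjk) (hik ▸ (hf (e k)).1.1)
    -- The common base at i and k lies in the data at j, hence is their base by restriction from k.
    exact congrArg f (inj ((he j).unique (IsBase.mono (hek ▸ he k)
      ((he i).isInitial.1.trans (hmono hij)) (hmono hjk))))
  · by_contra! hji
    have := key j i hji ((hf (e i)).1.1.trans hij.1)
    rw [this] at hij
    exact hij.ne rfl
  · obtain ⟨n₀, hn₀⟩ := exists_subset_contentInit hE.isInitial.1
    have hn : ∀ n, n₀ ≤ n → e n = E := fun n hn => inj ((he n).unique (hE.mono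
      (Finset.coe_subset.2 (hn₀.trans (contentInit_mono T hn))) (coe_contentInit_subset T n)))
    exact ⟨n₀, fun n h => by simp only [hn n h, hn n₀ le_rfl, hW, and_self]⟩

end LimitLearning

theorem mainTheorem4 (φ : ℕ → ℕ →. ℕ) (hφ : LimitLearning.IsAcceptable φ) :
    LimitLearning.TxtLearnable LimitLearning.Sd (LimitLearning.Ex φ) =
      LimitLearning.TxtLearnable LimitLearning.Sd
        (LimitLearning.Conv φ ⊓ LimitLearning.SDec φ ⊓ LimitLearning.Caut φ ⊓
          LimitLearning.Ex φ) := by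
  open LimitLearning in
  refine Set.ext fun 𝓛 => and_congr_right fun _ => ⟨?_, fun ⟨h, hh, hL⟩ =>
    ⟨h, hh, fun L hLL T hT => (hL L hLL T hT).2⟩⟩
  rintro ⟨h, hh, hL⟩
  obtain ⟨a, ha, hmono, hha⟩ := hh.exists_approx
  obtain ⟨w, hw, hwmono, hhw⟩ := (Partrec₂.unpaired'.2 hφ.1).exists_approx
  obtain ⟨f, hf, hfW⟩ := exists_index_conjecture hφ ha hw
  refine ⟨baseLearner a f, partrec_baseLearner ha hf, fun L hLL T hT => ?_⟩
  have hT' : content T = L := hT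
  have hdom : ∀ D : Finset ℕ, ↑D ⊆ L → (h (finsetCode D)).Dom := fun D hD => (hL L hLL).dom hD
  choose e he hp using fun i => exists_isBase_mem_baseLearner (f := f) hmono hha
    (D := contentInit T i) fun D' hD' => hdom D'
      ((Finset.coe_subset.2 hD').trans (hT' ▸ coe_contentInit_subset T i))
  obtain ⟨E, v, hE, hv, hvL⟩ := (hL L hLL).exists_isBase
  -- From here the base of L is handled through its canonical index.
  rw [← codedSet_finsetCode E] at hE
  have hconj : conjecture a w (finsetCode E) = L := by
    refine conjecture_eq hmono hwmono hha hE hv fun x => ?_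
    rw [← hvL]
    refine Part.dom_iff_mem.trans ?_
    have := fun y => hhw (Nat.pair v x) y
    simp only [Nat.unpaired, Nat.unpair_pair] at this
    simp only [this, Option.ne_none_iff_exists']
    exact exists_comm
  obtain ⟨h1, h2, h3, h4⟩ := restrictions_of_isBase (p := Sd (baseLearner a f) T) (T := T)
    (fun E => by
      rw [hfW]
      exact ⟨isInitial_conjecture E, stableOn_conjecture hmono hwmono hha E⟩)
    hp he (hT' ▸ hE) (by rw [hfW, hconj, hT'])
  exact ⟨⟨⟨h1, h2⟩, h3⟩, h4⟩
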